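/- Let $G = \langle a, b \mid bababa^{-1}b^2a^{-1},\ ababab^{-1}a^2b^{-1}\rangle$; this is the fundamental group of the Weeks manifold, the closed hyperbolic 3-manifold obtained by $(5/2, 5/1)$ Dehn surgery on the Whitehead link. Let $\mathrm{Homeo}(S^1)$ be the group of all (orientation-preserving or orientation-reversing) self-homeomorphisms of the circle. Then for every homomorphism $\rho\colon G \to \mathrm{Homeo}(S^1)$, the image $\rho(G)$ is either trivial or isomorphic to $\mathbb{Z}/5\mathbb{Z}$. -/

import Mathlib

/-- The generator `a` of the free group on two generators. -/
abbrev WeeksManifold.genA : FreeGroup (Fin 2) := FreeGroup.of 0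

/-- The generator `b` of the free group on two generators. -/
abbrev WeeksManifold.genB : FreeGroup (Fin 2) := FreeGroup.of 1

/-- The relator `b a b a b a⁻¹ b² a⁻¹`. -/
def WeeksManifold.relator₁ : FreeGroup (Fin 2) :=
  genB * genA * genB * genA * genB * genA⁻¹ * genB ^ 2 * genA⁻¹

/-- The relator `a b a b a b⁻¹ a² b⁻¹`. -/
def WeeksManifold.relator₂ : FreeGroup (Fin 2) :=
  genA * genB * genA * genB * genA * genB⁻¹ * genA ^ 2 * genB⁻¹

/-- The fundamental group of the Weeks manifold, the closed hyperbolic 3-manifold obtained by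
`(5/2, 5/1)` Dehn surgery on the Whitehead link, given by its presentation
`⟨a, b | b a b a b a⁻¹ b² a⁻¹, a b a b a b⁻¹ a² b⁻¹⟩`. -/
abbrev WeeksGroup : Type :=
  PresentedGroup ({WeeksManifold.relator₁, WeeksManifold.relator₂} : Set (FreeGroup (Fin 2)))

/-- `Homeo(S¹)`: the group, under composition, of all self-homeomorphisms of the unit circle,
orientation preserving or not. -/
abbrev HomeoCircle : Type := Circle ≃ₜ Circle

/-!
A total submonoid containing `a⁻¹` (resp. `a⁻¹ * b⁻¹`) is saturated under products, each of which
is rewritten by inserting conjugates of the two relators.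
-/

/-! Each relator has exponent sum 5 in one generator and 0 in the other, so both generators act
preserving orientation. They lift to increasing homeomorphisms `A`, `B` of the line commuting with
the central translation `z` by 2π, and the relators lift to `z ^ m` and `z ^ n`. The residues of
`(m, n)` mod 5 play the role of the Euler class. For each point `x`, the `g` with `x ≤ g x` form a
total submonoid, so words in the generators can be compared with 1. If `5 ∣ n`, rescaling `A` by a
power of `z` makes the second relator 1, and `mem_of_inv_mem_of_relators` forces the new `A` to be
trivial. If `5 ∣ m + n`, `mul_mem_of_inv_mul_inv_mem_of_relators` does the same for `B * A`.
Swapping the generators and replacing `b` by `a * b⁻¹` carries these two cases to all six lines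
through the origin in the plane over the field with 5 elements, which cover it; hence `A` and `B`
always commute. Then `B ^ 5 = z ^ m` and `A ^ 5 = z ^ n`, and torsion-freeness makes the image on
the circle cyclic, generated by an element whose fifth power is 1. -/

/-! ### Word computations in a total submonoid. -/

theorem mem_of_inv_mem_of_relators {Γ : Type*} [Group Γ] {a b z : Γ}
    (hz : ∀ g, g * z = z * g)
    (h1 : b * a * b * a * b * a⁻¹ * b ^ 2 * a⁻¹ = z)
    (h2 : a * b * a * b * a * b⁻¹ * a ^ 2 * b⁻¹ = 1)
    (N : Submonoid Γ) (hN : ∀ g, g ∈ N ∨ g⁻¹ ∈ N) (h : a⁻¹ ∈ N) : a ∈ N := by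
  have c1 : ∀ u, u * (b * a * b * a * b * a⁻¹ * b ^ 2 * a⁻¹) * u⁻¹ = z := by
    intro u; rw [h1, hz, mul_inv_cancel_right]
  have c1' : ∀ u, u * (b * a * b * a * b * a⁻¹ * b ^ 2 * a⁻¹)⁻¹ * u⁻¹ = z⁻¹ := by
    intro u; rw [← c1 u]; group
  have c2 : ∀ u, u * (a * b * a * b * a * b⁻¹ * a ^ 2 * b⁻¹) * u⁻¹ = 1 := by
    intro u; rw [h2, mul_one, mul_inv_cancel]
  have c2' : ∀ u, u * (a * b * a * b * a * b⁻¹ * a ^ 2 * b⁻¹)⁻¹ * u⁻¹ = 1 := by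
    intro u; rw [← inv_inj, ← (c2 u).trans inv_one.symm]; group
  -- In hypothesis names a capital letter denotes the inverse generator. In each identity `e`, the
  -- inserted conjugates of relators are central and their powers of `z` cancel, leaving a product
  -- of two known members.
  rcases hN (a⁻¹ * b * a⁻¹ * b⁻¹) with h1p | h1n
  · have h_Baba : b⁻¹ * a * b * a ∈ N := by
      have e : b⁻¹ * a * b * a = ((b⁻¹) * (a * b * a * b * a * b⁻¹ * a ^ 2 * b⁻¹) * (b⁻¹)⁻¹) *
          ((a⁻¹) * (a⁻¹ * b * a⁻¹ * b⁻¹)) := by group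
      simp only [c2] at e
      rw [e]
      simpa using N.mul_mem h h1p
    have h_ABaba : a⁻¹ * b⁻¹ * a * b * a ∈ N := by
      simpa [mul_assoc] using N.mul_mem h h_Baba
    have h_Baaba : b⁻¹ * a * a * b * a ∈ N := by
      simpa [mul_assoc] using N.mul_mem h_Baba h_ABaba
    have h_Baaaba : b⁻¹ * a * a * a * b * a ∈ N := by
      simpa [mul_assoc] using N.mul_mem h_Baaba h_ABaba
    have h_BaabaBaaaba : b⁻¹ * a * a * b * a * b⁻¹ * a * a * a * b * a ∈ N := by
      simpa [mul_assoc] using N.mul_mem h_Baaba h_Baaaba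
    have h_bAbaBaB : b * a⁻¹ * b * a * b⁻¹ * a * b⁻¹ ∈ N := by
      have e : b * a⁻¹ * b * a * b⁻¹ * a * b⁻¹ =
          ((b * a⁻¹ * b * a * b * a⁻¹) * (b * a * b * a * b * a⁻¹ * b ^ 2 * a⁻¹)⁻¹ * (b * a⁻¹ * b * a * b * a⁻¹)⁻¹) *
          ((b * a⁻¹ * b * a * b * a⁻¹) * (a * b * a * b * a * b⁻¹ * a ^ 2 * b⁻¹)⁻¹ * (b * a⁻¹ * b * a * b * a⁻¹)⁻¹) *
          ((b * a⁻¹ * b * a * b) * (a * b * a * b * a * b⁻¹ * a ^ 2 * b⁻¹)⁻¹ * (b * a⁻¹ * b * a * b)⁻¹) *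
          ((b * a⁻¹) * (b * a * b * a * b * a⁻¹ * b ^ 2 * a⁻¹) * (b * a⁻¹)⁻¹) *
          ((b⁻¹ * a * a * b * a * b⁻¹ * a * a * a * b * a) * (b⁻¹ * a * a * a * b * a)) := by group
      simp only [c1', c2', c1] at e
      rw [e]
      simpa using N.mul_mem h_BaabaBaaaba h_Baaaba
    have h_abaaB : a * b * a * a * b⁻¹ ∈ N := by
      have e : a * b * a * a * b⁻¹ =
          ((a * b * a * b * a⁻¹ * b * a⁻¹) * (b * a * b * a * b * a⁻¹ * b ^ 2 * a⁻¹)⁻¹ * (a * b * a * b * a⁻¹ * b * a⁻¹)⁻¹) *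
          ((a * b * a * b * a⁻¹ * b * a⁻¹) * (a * b * a * b * a * b⁻¹ * a ^ 2 * b⁻¹)⁻¹ * (a * b * a * b * a⁻¹ * b * a⁻¹)⁻¹) *
          ((b⁻¹) * (b * a * b * a * b * a⁻¹ * b ^ 2 * a⁻¹) * (b⁻¹)⁻¹) *
          ((b⁻¹ * a * a * b * a * b⁻¹ * a * a * a * b * a) * (b * a⁻¹ * b * a * b⁻¹ * a * b⁻¹)) := by group
      simp only [c1', c2', c1] at e
      rw [e]
      simpa using N.mul_mem h_BaabaBaaaba h_bAbaBaB
    have h_bAB : b * a⁻¹ * b⁻¹ ∈ N := by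
      have e : b * a⁻¹ * b⁻¹ = (1 * (a * b * a * b * a * b⁻¹ * a ^ 2 * b⁻¹)⁻¹ * 1⁻¹) *
          ((a * b * a * a * b⁻¹) * (b * a⁻¹ * b * a * b⁻¹ * a * b⁻¹)) := by group
      simp only [c2'] at e
      rw [e]
      simpa using N.mul_mem h_abaaB h_bAbaBaB
    have h_abaB : a * b * a * b⁻¹ ∈ N := by
      simpa [mul_assoc] using N.mul_mem h_abaaB h_bAB
    have h_a : a ∈ N := by
      simpa [mul_assoc] using N.mul_mem h_abaB h_bAB
    exact h_a
  · have h1n' : b * a * b⁻¹ * a ∈ N := by simpa [mul_assoc] using h1n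
    have h_baB : b * a * b⁻¹ ∈ N := by
      simpa [mul_assoc] using N.mul_mem h1n' h
    have h_baaB : b * a * a * b⁻¹ ∈ N := by
      simpa [mul_assoc] using N.mul_mem h_baB h_baB
    have h_bAbABaB : b * a⁻¹ * b * a⁻¹ * b⁻¹ * a * b⁻¹ ∈ N := by
      have e : b * a⁻¹ * b * a⁻¹ * b⁻¹ * a * b⁻¹ =
          ((b * a⁻¹ * b * a⁻¹ * b⁻¹ * a⁻¹ * b⁻¹ * a⁻¹) * (a * b * a * b * a * b⁻¹ * a ^ 2 * b⁻¹)⁻¹ * (b * a⁻¹ * b * a⁻¹ * b⁻¹ * a⁻¹ * b⁻¹ * a⁻¹)⁻¹) *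
          ((b * a * b⁻¹ * a) * (b * a * a * b⁻¹)) := by group
      simp only [c2'] at e
      rw [e]
      simpa using N.mul_mem h1n' h_baaB
    have h_bbABaB : b * b * a⁻¹ * b⁻¹ * a * b⁻¹ ∈ N := by
      simpa [mul_assoc] using N.mul_mem h_baB h_bAbABaB
    have h_AbbABaB : a⁻¹ * b * b * a⁻¹ * b⁻¹ * a * b⁻¹ ∈ N := by
      simpa [mul_assoc] using N.mul_mem h h_bbABaB
    have h_aBAAb : a * b⁻¹ * a⁻¹ * a⁻¹ * b ∈ N := by
      have e : a * b⁻¹ * a⁻¹ * a⁻¹ * b =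
          ((a * b⁻¹ * a⁻¹ * a⁻¹ * b * b * a⁻¹) * (b * a * b * a * b * a⁻¹ * b ^ 2 * a⁻¹) * (a * b⁻¹ * a⁻¹ * a⁻¹ * b * b * a⁻¹)⁻¹) *
          ((a * b⁻¹ * a⁻¹ * b⁻¹ * a⁻¹ * b⁻¹) * (b * a * b * a * b * a⁻¹ * b ^ 2 * a⁻¹)⁻¹ * (a * b⁻¹ * a⁻¹ * b⁻¹ * a⁻¹ * b⁻¹)⁻¹) *
          ((b * b * a⁻¹ * b⁻¹ * a * b⁻¹) * (b * a⁻¹ * b * a⁻¹ * b⁻¹ * a * b⁻¹)) := by group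
      simp only [c1, c1'] at e
      rw [e]
      simpa using N.mul_mem h_bbABaB h_bAbABaB
    have h_ABAAAb : a⁻¹ * b⁻¹ * a⁻¹ * a⁻¹ * a⁻¹ * b ∈ N := by
      have e : a⁻¹ * b⁻¹ * a⁻¹ * a⁻¹ * a⁻¹ * b =
          ((a⁻¹ * b⁻¹ * a⁻¹) * (a * b * a * b * a * b⁻¹ * a ^ 2 * b⁻¹)⁻¹ * (a⁻¹ * b⁻¹ * a⁻¹)⁻¹) *
          ((b * a * b⁻¹ * a) * (a * b⁻¹ * a⁻¹ * a⁻¹ * b)) := by group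
      simp only [c2'] at e
      rw [e]
      simpa using N.mul_mem h1n' h_aBAAb
    have h_aBaaaba : a * b⁻¹ * a * a * a * b * a ∈ N := by
      have e : a * b⁻¹ * a * a * a * b * a =
          ((a * b⁻¹ * a * a * a * b * a * b⁻¹ * a * a * b⁻¹) * (b * a * b * a * b * a⁻¹ * b ^ 2 * a⁻¹) * (a * b⁻¹ * a * a * a * b * a * b⁻¹ * a * a * b⁻¹)⁻¹) *
          ((a * b⁻¹ * a * a * b⁻¹ * a⁻¹) * (a * b * a * b * a * b⁻¹ * a ^ 2 * b⁻¹) * (a * b⁻¹ * a * a * b⁻¹ * a⁻¹)⁻¹) *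
          ((a * b⁻¹ * a) * (b * a * b * a * b * a⁻¹ * b ^ 2 * a⁻¹)⁻¹ * (a * b⁻¹ * a)⁻¹) *
          ((a * b⁻¹) * (a * b * a * b * a * b⁻¹ * a ^ 2 * b⁻¹) * (a * b⁻¹)⁻¹) *
          ((a⁻¹ * b * b * a⁻¹ * b⁻¹ * a * b⁻¹) * (a⁻¹ * b⁻¹ * a⁻¹ * a⁻¹ * a⁻¹ * b)) := by group
      simp only [c1, c2, c1'] at e
      rw [e]
      simpa using N.mul_mem h_AbbABaB h_ABAAAb
    have h_a : a ∈ N := by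
      simpa [mul_assoc] using N.mul_mem h_aBaaaba h_ABAAAb
    exact h_a

/-- Same method. The relators now have opposite values, so the central factors cancel when both
relators are inserted with equal total exponent. -/
theorem mul_mem_of_inv_mul_inv_mem_of_relators {Γ : Type*} [Group Γ] {a b z : Γ}
    (hz : ∀ g, g * z = z * g)
    (h1 : b * a * b * a * b * a⁻¹ * b ^ 2 * a⁻¹ = z)
    (h2 : a * b * a * b * a * b⁻¹ * a ^ 2 * b⁻¹ = z⁻¹)
    (N : Submonoid Γ) (hN : ∀ g, g ∈ N ∨ g⁻¹ ∈ N) (h : a⁻¹ * b⁻¹ ∈ N) : b * a ∈ N := by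
  have c1 : ∀ u, u * (b * a * b * a * b * a⁻¹ * b ^ 2 * a⁻¹) * u⁻¹ = z := by
    intro u; rw [h1, hz, mul_inv_cancel_right]
  have c1' : ∀ u, u * (b * a * b * a * b * a⁻¹ * b ^ 2 * a⁻¹)⁻¹ * u⁻¹ = z⁻¹ := by
    intro u; rw [← c1 u]; group
  have c2 : ∀ u, u * (a * b * a * b * a * b⁻¹ * a ^ 2 * b⁻¹) * u⁻¹ = z⁻¹ := by
    intro u; rw [h2, ← mul_right_inj z, mul_inv_cancel, ← mul_assoc, ← mul_assoc, ← hz,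
      mul_inv_cancel_right, mul_inv_cancel]
  have c2' : ∀ u, u * (a * b * a * b * a * b⁻¹ * a ^ 2 * b⁻¹)⁻¹ * u⁻¹ = z := by
    intro u; rw [← inv_inj, ← c2 u]; group
  rcases hN (b * a⁻¹ * a⁻¹ * b⁻¹ * a * b⁻¹) with hp | hn
  · have h_bAABABaB : b * a⁻¹ * a⁻¹ * b⁻¹ * a⁻¹ * b⁻¹ * a * b⁻¹ ∈ N := by
      simpa [mul_assoc] using N.mul_mem hp hp
    have h_ABAB : a⁻¹ * b⁻¹ * a⁻¹ * b⁻¹ ∈ N := by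
      simpa [mul_assoc] using N.mul_mem h h
    have h_abab : a * b * a * b ∈ N := by
      have e : a * b * a * b =
          ((a * b * a * b) * (b * a * b * a * b * a⁻¹ * b ^ 2 * a⁻¹) * (a * b * a * b)⁻¹) *
          (1 * (a * b * a * b * a * b⁻¹ * a ^ 2 * b⁻¹) * 1⁻¹) *
          ((b * a⁻¹ * a⁻¹ * b⁻¹ * a * b⁻¹) * (a⁻¹ * b⁻¹ * a⁻¹ * b⁻¹)) := by group
      simp only [c1, c2] at e
      rw [e]
      simpa using N.mul_mem hp h_ABAB
    have h_bABa : b * a⁻¹ * b⁻¹ * a ∈ N := by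
      have e : b * a⁻¹ * b⁻¹ * a =
          ((b * a⁻¹ * b⁻¹ * a * b⁻¹ * a⁻¹ * b⁻¹ * a⁻¹ * b * a⁻¹) * (b * a * b * a * b * a⁻¹ * b ^ 2 * a⁻¹) * (b * a⁻¹ * b⁻¹ * a * b⁻¹ * a⁻¹ * b⁻¹ * a⁻¹ * b * a⁻¹)⁻¹) *
          ((b * a⁻¹ * b⁻¹ * a * b⁻¹ * a⁻¹ * b⁻¹ * a⁻¹ * b⁻¹) * (b * a * b * a * b * a⁻¹ * b ^ 2 * a⁻¹)⁻¹ * (b * a⁻¹ * b⁻¹ * a * b⁻¹ * a⁻¹ * b⁻¹ * a⁻¹ * b⁻¹)⁻¹) *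
          ((b * a⁻¹ * a⁻¹ * b⁻¹ * a⁻¹ * b⁻¹ * a * b⁻¹) * (a * b * a * b)) := by group
      simp only [c1, c1'] at e
      rw [e]
      simpa using N.mul_mem h_bAABABaB h_abab
    have h_bABB : b * a⁻¹ * b⁻¹ * b⁻¹ ∈ N := by
      simpa [mul_assoc] using N.mul_mem h_bABa h
    have h_bABABB : b * a⁻¹ * b⁻¹ * a⁻¹ * b⁻¹ * b⁻¹ ∈ N := by
      simpa [mul_assoc] using N.mul_mem h_bABB h_bABB
    have h_ab : a * b ∈ N := by
      have e : a * b =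
          ((a * b * b * a⁻¹) * (b * a * b * a * b * a⁻¹ * b ^ 2 * a⁻¹) * (a * b * b * a⁻¹)⁻¹) *
          ((a * a * b⁻¹) * (a * b * a * b * a * b⁻¹ * a ^ 2 * b⁻¹) * (a * a * b⁻¹)⁻¹) *
          ((b * a⁻¹ * b⁻¹ * a⁻¹ * b⁻¹ * b⁻¹) * (b * a⁻¹ * a⁻¹ * b⁻¹ * a⁻¹ * b⁻¹ * a * b⁻¹)) := by group
      simp only [c1, c2] at e
      rw [e]
      simpa using N.mul_mem h_bABABB h_bAABABaB
    have h_bABaBA : b * a⁻¹ * b⁻¹ * a * b⁻¹ * a⁻¹ ∈ N := by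
      have e : b * a⁻¹ * b⁻¹ * a * b⁻¹ * a⁻¹ =
          ((b * a⁻¹ * b⁻¹ * a * b⁻¹ * a⁻¹ * b⁻¹ * a⁻¹ * b * a⁻¹) * (b * a * b * a * b * a⁻¹ * b ^ 2 * a⁻¹) * (b * a⁻¹ * b⁻¹ * a * b⁻¹ * a⁻¹ * b⁻¹ * a⁻¹ * b * a⁻¹)⁻¹) *
          ((b * a⁻¹ * b⁻¹ * a * b⁻¹ * a⁻¹ * b⁻¹ * a⁻¹ * b⁻¹) * (b * a * b * a * b * a⁻¹ * b ^ 2 * a⁻¹)⁻¹ * (b * a⁻¹ * b⁻¹ * a * b⁻¹ * a⁻¹ * b⁻¹ * a⁻¹ * b⁻¹)⁻¹) *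
          ((b * a⁻¹ * a⁻¹ * b⁻¹ * a⁻¹ * b⁻¹ * a * b⁻¹) * (a * b)) := by group
      simp only [c1, c1'] at e
      rw [e]
      simpa using N.mul_mem h_bAABABaB h_ab
    have h_aabA : a * a * b * a⁻¹ ∈ N := by
      have e : a * a * b * a⁻¹ =
          ((a * a * b * a⁻¹) * (b * a * b * a * b * a⁻¹ * b ^ 2 * a⁻¹) * (a * a * b * a⁻¹)⁻¹) *
          ((a * a * b⁻¹) * (a * b * a * b * a * b⁻¹ * a ^ 2 * b⁻¹) * (a * a * b⁻¹)⁻¹) *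
          ((b * a⁻¹ * b⁻¹ * a⁻¹ * b⁻¹ * b⁻¹) * (a⁻¹ * b⁻¹ * a⁻¹ * b⁻¹)) := by group
      simp only [c1, c2] at e
      rw [e]
      simpa using N.mul_mem h_bABABB h_ABAB
    have h_aababA : a * a * b * a * b * a⁻¹ ∈ N := by
      simpa [mul_assoc] using N.mul_mem h_aabA h_aabA
    have h_bbaB : b * b * a * b⁻¹ ∈ N := by
      have e : b * b * a * b⁻¹ =
          ((b * b * a * b * a⁻¹) * (b * a * b * a * b * a⁻¹ * b ^ 2 * a⁻¹)⁻¹ * (b * b * a * b * a⁻¹)⁻¹) *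
          ((b * b * a * b * a⁻¹ * b * b * a⁻¹) * (b * a * b * a * b * a⁻¹ * b ^ 2 * a⁻¹) * (b * b * a * b * a⁻¹ * b * b * a⁻¹)⁻¹) *
          ((b * a⁻¹ * b⁻¹ * a * b⁻¹ * a⁻¹) * (a * a * b * a * b * a⁻¹)) := by group
      simp only [c1', c1] at e
      rw [e]
      simpa using N.mul_mem h_bABaBA h_aababA
    have h_ba : b * a ∈ N := by
      simpa [mul_assoc] using N.mul_mem h_bbaB h_bABa
    exact h_ba
  · have hn' : b * a⁻¹ * b * a * a * b⁻¹ ∈ N := by simpa [mul_assoc] using hn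
    rcases hN (b * a⁻¹ * b⁻¹ * a⁻¹ * b⁻¹ * b⁻¹) with hp | hm
    · have h_bAbaaBAB : b * a⁻¹ * b * a * a * b⁻¹ * a⁻¹ * b⁻¹ ∈ N := by
        simpa [mul_assoc] using N.mul_mem hn' h
      have h_BaBAbA : b⁻¹ * a * b⁻¹ * a⁻¹ * b * a⁻¹ ∈ N := by
        have e : b⁻¹ * a * b⁻¹ * a⁻¹ * b * a⁻¹ =
            ((b⁻¹ * a * b⁻¹ * a⁻¹ * b * a⁻¹) * (b * a * b * a * b * a⁻¹ * b ^ 2 * a⁻¹) * (b⁻¹ * a * b⁻¹ * a⁻¹ * b * a⁻¹)⁻¹) *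
            ((b⁻¹ * a * b⁻¹ * a⁻¹ * b⁻¹ * a⁻¹ * b⁻¹) * (b * a * b * a * b * a⁻¹ * b ^ 2 * a⁻¹)⁻¹ * (b⁻¹ * a * b⁻¹ * a⁻¹ * b⁻¹ * a⁻¹ * b⁻¹)⁻¹) *
            ((b * a⁻¹ * b * a * a * b⁻¹ * a⁻¹ * b⁻¹) * (a⁻¹ * b⁻¹)) := by group
        simp only [c1, c1'] at e
        rw [e]
        simpa using N.mul_mem h_bAbaaBAB h
      have h_aabAba : a * a * b * a⁻¹ * b * a ∈ N := by
        have e : a * a * b * a⁻¹ * b * a =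
            ((a * a * b * a⁻¹) * (b * a * b * a * b * a⁻¹ * b ^ 2 * a⁻¹) * (a * a * b * a⁻¹)⁻¹) *
            ((a * a * b⁻¹) * (a * b * a * b * a * b⁻¹ * a ^ 2 * b⁻¹) * (a * a * b⁻¹)⁻¹) *
            ((b * a⁻¹ * b⁻¹ * a⁻¹ * b⁻¹ * b⁻¹) * (a⁻¹ * b⁻¹)) := by group
        simp only [c1, c2] at e
        rw [e]
        simpa using N.mul_mem hp h
      have h_aabA : a * a * b * a⁻¹ ∈ N := by
        simpa [mul_assoc] using N.mul_mem h_aabAba h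
      have h_aababAba : a * a * b * a * b * a⁻¹ * b * a ∈ N := by
        simpa [mul_assoc] using N.mul_mem h_aabA h_aabAba
      have h_abab : a * b * a * b ∈ N := by
        have e : a * b * a * b =
            ((a * b * a * b * a⁻¹ * b * a⁻¹) * (b * a * b * a * b * a⁻¹ * b ^ 2 * a⁻¹)⁻¹ * (a * b * a * b * a⁻¹ * b * a⁻¹)⁻¹) *
            ((b⁻¹) * (b * a * b * a * b * a⁻¹ * b ^ 2 * a⁻¹) * (b⁻¹)⁻¹) *
            ((b⁻¹ * a * b⁻¹ * a⁻¹ * b * a⁻¹) * (a * a * b * a * b * a⁻¹ * b * a)) := by group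
        simp only [c1', c1] at e
        rw [e]
        simpa using N.mul_mem h_BaBAbA h_aababAba
      have h_bABa : b * a⁻¹ * b⁻¹ * a ∈ N := by
        have e : b * a⁻¹ * b⁻¹ * a =
            ((b * a⁻¹ * a⁻¹) * (b * a * b * a * b * a⁻¹ * b ^ 2 * a⁻¹)⁻¹ * (b * a⁻¹ * a⁻¹)⁻¹) *
            (1 * (a * b * a * b * a * b⁻¹ * a ^ 2 * b⁻¹)⁻¹ * 1⁻¹) *
            ((a * b * a * b) * (a * a * b * a * b * a⁻¹ * b * a)) := by group
        simp only [c1', c2'] at e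
        rw [e]
        simpa using N.mul_mem h_abab h_aababAba
      have h_BabA : b⁻¹ * a * b * a⁻¹ ∈ N := by
        have e : b⁻¹ * a * b * a⁻¹ =
            ((b⁻¹ * a * b⁻¹ * a⁻¹ * b⁻¹) * (b * a * b * a * b * a⁻¹ * b ^ 2 * a⁻¹) * (b⁻¹ * a * b⁻¹ * a⁻¹ * b⁻¹)⁻¹) *
            ((b⁻¹ * a * b⁻¹ * a⁻¹ * b⁻¹ * a⁻¹ * b⁻¹) * (b * a * b * a * b * a⁻¹ * b ^ 2 * a⁻¹)⁻¹ * (b⁻¹ * a * b⁻¹ * a⁻¹ * b⁻¹ * a⁻¹ * b⁻¹)⁻¹) *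
            ((b * a⁻¹ * b * a * a * b⁻¹) * (b⁻¹ * a * b⁻¹ * a⁻¹ * b * a⁻¹)) := by group
        simp only [c1, c1'] at e
        rw [e]
        simpa using N.mul_mem hn' h_BaBAbA
      have h_BababA : b⁻¹ * a * b * a * b * a⁻¹ ∈ N := by
        simpa [mul_assoc] using N.mul_mem h_BabA h_aabA
      have h_Abaa : a⁻¹ * b * a * a ∈ N := by
        have e : a⁻¹ * b * a * a =
            ((a⁻¹ * b * a * b * a * b * a⁻¹) * (b * a * b * a * b * a⁻¹ * b ^ 2 * a⁻¹)⁻¹ * (a⁻¹ * b * a * b * a * b * a⁻¹)⁻¹) *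
            ((a⁻¹) * (b * a * b * a * b * a⁻¹ * b ^ 2 * a⁻¹) * (a⁻¹)⁻¹) *
            ((b⁻¹ * a * b * a * b * a⁻¹) * (b * a⁻¹ * b⁻¹ * a)) := by group
        simp only [c1', c1] at e
        rw [e]
        simpa using N.mul_mem h_BababA h_bABa
      have h_ba : b * a ∈ N := by
        simpa [mul_assoc] using N.mul_mem h_bABa h_Abaa
      exact h_ba
    · have hm' : b * b * a * b * a * b⁻¹ ∈ N := by simpa [mul_assoc] using hm
      have h_bAbabaaB : b * a⁻¹ * b * a * b * a * a * b⁻¹ ∈ N := by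
        simpa [mul_assoc] using N.mul_mem hn' hn'
      have h_BA : b⁻¹ * a⁻¹ ∈ N := by
        have e : b⁻¹ * a⁻¹ =
            ((b⁻¹ * a * b⁻¹) * (a * b * a * b * a * b⁻¹ * a ^ 2 * b⁻¹)⁻¹ * (b⁻¹ * a * b⁻¹)⁻¹) *
            ((b⁻¹ * a * b⁻¹ * a⁻¹ * b⁻¹ * a⁻¹ * b⁻¹) * (b * a * b * a * b * a⁻¹ * b ^ 2 * a⁻¹)⁻¹ * (b⁻¹ * a * b⁻¹ * a⁻¹ * b⁻¹ * a⁻¹ * b⁻¹)⁻¹) *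
            ((b * a⁻¹ * b * a * b * a * a * b⁻¹) * (b * b * a * b * a * b⁻¹)) := by group
        simp only [c2', c1'] at e
        rw [e]
        simpa using N.mul_mem h_bAbabaaB hm'
      have h_abAbaB : a * b * a⁻¹ * b * a * b⁻¹ ∈ N := by
        have e : a * b * a⁻¹ * b * a * b⁻¹ =
            ((a * b * a⁻¹ * b * a⁻¹ * b⁻¹ * a⁻¹ * b⁻¹) * (b * a * b * a * b * a⁻¹ * b ^ 2 * a⁻¹)⁻¹ * (a * b * a⁻¹ * b * a⁻¹ * b⁻¹ * a⁻¹ * b⁻¹)⁻¹) *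
            ((a * b * a⁻¹ * b * b * a⁻¹) * (b * a * b * a * b * a⁻¹ * b ^ 2 * a⁻¹) * (a * b * a⁻¹ * b * b * a⁻¹)⁻¹) *
            ((b⁻¹ * a⁻¹) * (b * a⁻¹ * b * a * b * a * a * b⁻¹)) := by group
        simp only [c1', c1] at e
        rw [e]
        simpa using N.mul_mem h_BA h_bAbabaaB
      have h_ABBA : a⁻¹ * b⁻¹ * b⁻¹ * a⁻¹ ∈ N := by
        simpa [mul_assoc] using N.mul_mem h h_BA
      have h_abAbABaB : a * b * a⁻¹ * b * a⁻¹ * b⁻¹ * a * b⁻¹ ∈ N := by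
        have e : a * b * a⁻¹ * b * a⁻¹ * b⁻¹ * a * b⁻¹ =
            ((a * b * a⁻¹ * b * a⁻¹ * b⁻¹ * a⁻¹ * b⁻¹) * (b * a * b * a * b * a⁻¹ * b ^ 2 * a⁻¹)⁻¹ * (a * b * a⁻¹ * b * a⁻¹ * b⁻¹ * a⁻¹ * b⁻¹)⁻¹) *
            ((a * b * a⁻¹ * b * b * a⁻¹) * (b * a * b * a * b * a⁻¹ * b ^ 2 * a⁻¹) * (a * b * a⁻¹ * b * b * a⁻¹)⁻¹) *
            ((b⁻¹ * a⁻¹) * (b * a⁻¹ * b * a * a * b⁻¹)) := by group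
        simp only [c1', c1] at e
        rw [e]
        simpa using N.mul_mem h_BA hn'
      have h_ABAbABaB : a⁻¹ * b⁻¹ * a⁻¹ * b * a⁻¹ * b⁻¹ * a * b⁻¹ ∈ N := by
        simpa [mul_assoc] using N.mul_mem h_ABBA h_abAbABaB
      have h_baBA : b * a * b⁻¹ * a⁻¹ ∈ N := by
        have e : b * a * b⁻¹ * a⁻¹ =
            ((b * a * b⁻¹ * a * b⁻¹) * (a * b * a * b * a * b⁻¹ * a ^ 2 * b⁻¹)⁻¹ * (b * a * b⁻¹ * a * b⁻¹)⁻¹) *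
            ((b * a * b⁻¹ * a * a * b⁻¹) * (a * b * a * b * a * b⁻¹ * a ^ 2 * b⁻¹) * (b * a * b⁻¹ * a * a * b⁻¹)⁻¹) *
            ((a⁻¹ * b⁻¹ * a⁻¹ * b * a⁻¹ * b⁻¹ * a * b⁻¹) * (b * b * a * b * a * b⁻¹)) := by group
        simp only [c2', c2] at e
        rw [e]
        simpa using N.mul_mem h_ABAbABaB hm'
      have h_bbaB : b * b * a * b⁻¹ ∈ N := by
        simpa [mul_assoc] using N.mul_mem h_baBA h_abAbaB
      have h_abAbabaB : a * b * a⁻¹ * b * a * b * a * b⁻¹ ∈ N := by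
        simpa [mul_assoc] using N.mul_mem h_abAbaB h_bbaB
      have h_bbABaB : b * b * a⁻¹ * b⁻¹ * a * b⁻¹ ∈ N := by
        simpa [mul_assoc] using N.mul_mem h_baBA h_abAbABaB
      have h_baba : b * a * b * a ∈ N := by
        have e : b * a * b * a =
            ((b * a * b * a * b * a⁻¹ * b * a * b⁻¹ * a⁻¹ * b⁻¹ * a⁻¹ * b⁻¹) * (b * a * b * a * b * a⁻¹ * b ^ 2 * a⁻¹)⁻¹ * (b * a * b * a * b * a⁻¹ * b * a * b⁻¹ * a⁻¹ * b⁻¹ * a⁻¹ * b⁻¹)⁻¹) *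
            (1 * (b * a * b * a * b * a⁻¹ * b ^ 2 * a⁻¹) * 1⁻¹) *
            ((a * b * a⁻¹ * b * a * b * a * b⁻¹) * (b * b * a⁻¹ * b⁻¹ * a * b⁻¹)) := by group
        simp only [c1', c1] at e
        rw [e]
        simpa using N.mul_mem h_abAbabaB h_bbABaB
      have h_ba : b * a ∈ N := by
        simpa [mul_assoc] using N.mul_mem h_baba h
      exact h_ba

/-! ### Separating families of total submonoids. -/

open Pointwise in
theorem inv_total {Γ : Type*} [Group Γ] {N : Submonoid Γ} (hN : ∀ g, g ∈ N ∨ g⁻¹ ∈ N) (g : Γ) :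
    g ∈ N⁻¹ ∨ g⁻¹ ∈ N⁻¹ := by
  simpa only [Submonoid.mem_inv] using hN g⁻¹

/-- A family of total submonoids of a group that jointly separate points, such as the family of
the sets `{g | x ≤ g x}` for a group acting faithfully by order automorphisms. -/
structure IsSeparatingFamily {Γ ι : Type*} [Group Γ] (N : ι → Submonoid Γ) : Prop where
  total : ∀ i g, g ∈ N i ∨ g⁻¹ ∈ N i
  eq_one : ∀ g, (∀ i, g ∈ N i ∧ g⁻¹ ∈ N i) → g = 1

theorem relator_eq_pow_of_commute {Γ : Type*} [Group Γ] {a b : Γ} (hab : Commute a b) :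
    a * b * a * b * a * b⁻¹ * a ^ 2 * b⁻¹ = a ^ 5 := by
  have l (x : Γ) : x * b * a = x * a * b := by rw [mul_assoc, ← hab.eq, mul_assoc]
  simp [l, pow_succ, ← mul_assoc]

namespace IsSeparatingFamily

variable {Γ ι : Type*} [Group Γ] {N : ι → Submonoid Γ} {a b z : Γ}

/-- The inverse of a torsion element is a positive power of it, so it lies in the same submonoids.
-/
theorem eq_one_of_pow_eq_one (hN : IsSeparatingFamily N) {g : Γ} {k : ℕ} (hg : g ^ (k + 1) = 1) :
    g = 1 := by
  have key : ∀ i, ∀ h : Γ, h ^ (k + 1) = 1 → h ∈ N i → h⁻¹ ∈ N i := by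
    intro i h hh hi
    rw [inv_eq_of_mul_eq_one_right (b := h ^ k) (by rw [← pow_succ', hh])]
    exact pow_mem hi k
  refine hN.eq_one g fun i => ?_
  rcases hN.total i g with h | h
  · exact ⟨h, key i g hg h⟩
  · exact ⟨by simpa using key i g⁻¹ (by rw [inv_pow, hg, inv_one]) h, h⟩

-- Applying the word computation to both `N i` and `(N i)⁻¹`, the reversed order, puts `a` and `a⁻¹`
-- in every `N i`.
open Pointwise in
theorem eq_one_of_relators (hN : IsSeparatingFamily N) (hz : ∀ g, g * z = z * g)
    (h1 : b * a * b * a * b * a⁻¹ * b ^ 2 * a⁻¹ = z)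
    (h2 : a * b * a * b * a * b⁻¹ * a ^ 2 * b⁻¹ = 1) : a = 1 := by
  refine hN.eq_one a fun i => ?_
  have key := mem_of_inv_mem_of_relators hz h1 h2
  rcases hN.total i a with h | h
  · refine ⟨h, ?_⟩
    have := key (N i)⁻¹ (inv_total (hN.total i)) (by simpa [Submonoid.mem_inv] using h)
    simpa [Submonoid.mem_inv] using this
  · exact ⟨key (N i) (hN.total i) h, h⟩

open Pointwise in
theorem mul_eq_one_of_relators (hN : IsSeparatingFamily N) (hz : ∀ g, g * z = z * g)
    (h1 : b * a * b * a * b * a⁻¹ * b ^ 2 * a⁻¹ = z)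
    (h2 : a * b * a * b * a * b⁻¹ * a ^ 2 * b⁻¹ = z⁻¹) : b * a = 1 := by
  refine hN.eq_one (b * a) fun i => ?_
  have key := mul_mem_of_inv_mul_inv_mem_of_relators hz h1 h2
  rcases hN.total i (b * a) with h | h
  · refine ⟨h, ?_⟩
    have := key (N i)⁻¹ (inv_total (hN.total i)) (by simpa [Submonoid.mem_inv] using h)
    simpa [Submonoid.mem_inv] using this
  · exact ⟨key (N i) (hN.total i) (by simpa using h), h⟩

/-! ### Central values of the relators and their residues mod 5. -/

section

variable {m n : ℤ}

/-- Multiplying `a` by a central element `c` does not change the first relator. -/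
theorem relator₁_mul_central {c : Γ} (hc : ∀ g, c * g = g * c) :
    b * (a * c) * b * (a * c) * b * (a * c)⁻¹ * b ^ 2 * (a * c)⁻¹ =
      b * a * b * a * b * a⁻¹ * b ^ 2 * a⁻¹ := by
  have hc' : ∀ g, c⁻¹ * g = g * c⁻¹ := fun g => (Commute.inv_left (hc g) : Commute c⁻¹ g)
  have e (x : Γ) : (x * c)⁻¹ = x⁻¹ * c⁻¹ := by rw [mul_inv_rev, hc']
  have l (x y : Γ) : x * c * y = x * y * c := by rw [mul_assoc, hc, mul_assoc]
  simp only [e, l _ a, l _ b, l _ a⁻¹, pow_two, ← mul_assoc,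
    mul_inv_cancel_right]

theorem relator₂_mul_central {c : Γ} (hc : ∀ g, c * g = g * c) :
    (a * c) * b * (a * c) * b * (a * c) * b⁻¹ * (a * c) ^ 2 * b⁻¹ =
      a * b * a * b * a * b⁻¹ * a ^ 2 * b⁻¹ * c ^ 5 := by
  have l (x y : Γ) : x * c * y = x * y * c := by rw [mul_assoc, hc, mul_assoc]
  simp only [l _ a, l _ b, l _ b⁻¹, ← mul_assoc, pow_succ, pow_zero, one_mul]

theorem zpow_central (hz : ∀ g, g * z = z * g) (k : ℤ) (g : Γ) : z ^ k * g = g * z ^ k :=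
  (Commute.zpow_left (hz g).symm k : Commute (z ^ k) g)

/-- Replacing `a` by `a * z ^ (-k)` kills the second relator and keeps the first, so `a` itself is a
power of `z`. -/
theorem commute_of_dvd_right (hN : IsSeparatingFamily N) (hz : ∀ g, g * z = z * g)
    (h1 : b * a * b * a * b * a⁻¹ * b ^ 2 * a⁻¹ = z ^ m)
    (h2 : a * b * a * b * a * b⁻¹ * a ^ 2 * b⁻¹ = z ^ n) (hn : 5 ∣ n) : a * b = b * a := by
  obtain ⟨k, rfl⟩ := hn
  have hc := zpow_central hz (-k)
  have := hN.eq_one_of_relators (a := a * z ^ (-k)) (fun g => (zpow_central hz m g).symm)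
    ((relator₁_mul_central hc).trans h1)
    (by rw [relator₂_mul_central hc, h2, ← zpow_natCast, ← zpow_mul, ← zpow_add]
        simp [mul_comm])
  rw [zpow_neg, mul_inv_eq_one] at this
  rw [this, zpow_central hz]

/-- The same rescaling makes the relator values mutually inverse, so `b * a` is a power of `z`. -/
theorem commute_of_dvd_add (hN : IsSeparatingFamily N) (hz : ∀ g, g * z = z * g)
    (h1 : b * a * b * a * b * a⁻¹ * b ^ 2 * a⁻¹ = z ^ m)
    (h2 : a * b * a * b * a * b⁻¹ * a ^ 2 * b⁻¹ = z ^ n) (hn : 5 ∣ m + n) : a * b = b * a := by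
  obtain ⟨k, hk⟩ := hn
  obtain rfl : n = 5 * k - m := by lia
  have hc := zpow_central hz (-k)
  have := hN.mul_eq_one_of_relators (a := a * z ^ (-k)) (fun g => (zpow_central hz m g).symm)
    ((relator₁_mul_central hc).trans h1)
    (by rw [relator₂_mul_central hc, h2, ← zpow_natCast, ← zpow_mul, ← zpow_add, ← zpow_neg]
        congr 1; push_cast; ring)
  rw [zpow_neg, ← mul_assoc, mul_inv_eq_one] at this
  rw [this, eq_comm, eq_inv_mul_of_mul_eq this, mul_assoc, zpow_central hz, inv_mul_cancel_left]

/-- With `relator₂_mul_inv`, this says that substituting `a * b⁻¹` for `b` respects the relations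
and sends the exponents `(m, n)` to `(n - m, n)`. -/
theorem relator₁_mul_inv (hz : ∀ g, g * z = z * g)
    (h1 : b * a * b * a * b * a⁻¹ * b ^ 2 * a⁻¹ = z ^ m)
    (h2 : a * b * a * b * a * b⁻¹ * a ^ 2 * b⁻¹ = z ^ n) :
    (a * b⁻¹) * a * (a * b⁻¹) * a * (a * b⁻¹) * a⁻¹ * (a * b⁻¹) ^ 2 * a⁻¹ = z ^ (n - m) := by
  have e : (a * b⁻¹) * a * (a * b⁻¹) * a * (a * b⁻¹) * a⁻¹ * (a * b⁻¹) ^ 2 * a⁻¹ =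
      (a * b⁻¹ * a * a * b⁻¹ * a) * (b * a * b * a * b * a⁻¹ * b ^ 2 * a⁻¹)⁻¹ *
        (a * b⁻¹ * a * a * b⁻¹ * a)⁻¹ * ((a * b⁻¹ * a * a * b⁻¹) *
        (a * b * a * b * a * b⁻¹ * a ^ 2 * b⁻¹) * (a * b⁻¹ * a * a * b⁻¹)⁻¹) := by
    simp only [pow_two]; group
  rw [e, h1, h2, ← zpow_neg, ← zpow_central hz (-m), ← zpow_central hz n, mul_inv_cancel_right,
    mul_inv_cancel_right, ← zpow_add, neg_add_eq_sub]

theorem relator₂_mul_inv (hz : ∀ g, g * z = z * g)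
    (h2 : a * b * a * b * a * b⁻¹ * a ^ 2 * b⁻¹ = z ^ n) :
    a * (a * b⁻¹) * a * (a * b⁻¹) * a * (a * b⁻¹)⁻¹ * a ^ 2 * (a * b⁻¹)⁻¹ = z ^ n := by
  have e : a * (a * b⁻¹) * a * (a * b⁻¹) * a * (a * b⁻¹)⁻¹ * a ^ 2 * (a * b⁻¹)⁻¹ =
      (a * a * b⁻¹ * a * a * b⁻¹) * (a * b * a * b * a * b⁻¹ * a ^ 2 * b⁻¹) *
        (a * a * b⁻¹ * a * a * b⁻¹)⁻¹ := by group
  rw [e, h2, ← zpow_central hz, mul_inv_cancel_right]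

theorem commute_of_commute_mul_inv (h : a * (a * b⁻¹) = a * b⁻¹ * a) : a * b = b * a := by
  have h' : Commute a (a * b⁻¹) := h
  have : Commute a ((a * b⁻¹)⁻¹ * a) := h'.inv_right.mul_right (Commute.refl a)
  simpa [mul_assoc] using this.eq

theorem commute_of_relators (hN : IsSeparatingFamily N) (hz : ∀ g, g * z = z * g)
    (h1 : b * a * b * a * b * a⁻¹ * b ^ 2 * a⁻¹ = z ^ m)
    (h2 : a * b * a * b * a * b⁻¹ * a ^ 2 * b⁻¹ = z ^ n) : a * b = b * a := by
  -- These are the six points of the projective line over the field with 5 elements, so every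
  -- residue pair satisfies one of them.
  have h : 5 ∣ n ∨ 5 ∣ m ∨ 5 ∣ m + n ∨ 5 ∣ n - m ∨ 5 ∣ n - m + n ∨ 5 ∣ m - n + m := by lia
  have h3 := relator₁_mul_inv hz h1 h2
  have h4 := relator₂_mul_inv hz h2
  have h5 := relator₁_mul_inv hz h2 h1
  have h6 := relator₂_mul_inv hz h1
  rcases h with h | h | h | h | h | h
  · exact hN.commute_of_dvd_right hz h1 h2 h
  · exact (hN.commute_of_dvd_right hz h2 h1 h).symm
  · exact hN.commute_of_dvd_add hz h1 h2 h
  · exact commute_of_commute_mul_inv (hN.commute_of_dvd_right hz h4 h3 h).symm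
  · exact commute_of_commute_mul_inv (hN.commute_of_dvd_add hz h3 h4 h)
  · exact (commute_of_commute_mul_inv (hN.commute_of_dvd_add hz h5 h6 h)).symm

theorem exists_powers_of_relators (hN : IsSeparatingFamily N) (hz : ∀ g, g * z = z * g)
    (h1 : b * a * b * a * b * a⁻¹ * b ^ 2 * a⁻¹ = z ^ m)
    (h2 : a * b * a * b * a * b⁻¹ * a ^ 2 * b⁻¹ = z ^ n) :
    (∃ k : ℤ, b = z ^ k) ∨ ∃ k l : ℤ, a = b ^ k * z ^ l := by
  have hab : Commute a b := hN.commute_of_relators hz h1 h2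
  have hza : Commute a z := hz a
  have hzb : Commute b z := hz b
  have hb : b ^ 5 = z ^ m := by
    rw [← h1, relator_eq_pow_of_commute hab.symm]
  have ha : a ^ 5 = z ^ n := by
    rw [← h2, relator_eq_pow_of_commute hab]
  by_cases hm : (5 : ℤ) ∣ m
  · left
    obtain ⟨k, rfl⟩ := hm
    refine ⟨k, ?_⟩
    rw [← mul_inv_eq_one]
    refine hN.eq_one_of_pow_eq_one (k := 4) ?_
    rw [(hzb.zpow_right k).inv_right.mul_pow, hb, inv_pow, ← zpow_natCast, ← zpow_mul,
      mul_comm k, mul_inv_eq_one]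
    rfl
  · right
    have hc : IsCoprime m 5 :=
      ((Int.prime_iff_natAbs_prime.2 (by norm_num)).coprime_iff_not_dvd.2 hm).symm
    obtain ⟨u, v, huv⟩ := hc
    -- Since `u * m + v * 5 = 1`, both sides have fifth power `z ^ n`; they commute, so their
    -- quotient is torsion and hence trivial.
    refine ⟨n * u, n * v, ?_⟩
    have comm : Commute a (b ^ (n * u) * z ^ (n * v)) :=
      (hab.zpow_right _).mul_right (hza.zpow_right _)
    rw [← mul_inv_eq_one]
    refine hN.eq_one_of_pow_eq_one (k := 4) ?_
    rw [comm.inv_right.mul_pow, inv_pow, mul_inv_eq_one, ((hzb.zpow_left _).zpow_right _).mul_pow]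
    have hb' : (b ^ (n * u)) ^ 5 = z ^ (m * (n * u)) := by
      rw [← zpow_natCast, ← zpow_mul, mul_comm, zpow_mul, zpow_natCast, hb, ← zpow_mul]
    rw [ha, hb', ← zpow_natCast, ← zpow_mul, ← zpow_add]
    congr 1
    push_cast
    linear_combination (-n) * huv

end

end IsSeparatingFamily

/-! ### Lifting circle homeomorphisms to the line. -/

namespace CircleLift

theorem exists_homeomorph_lift (f : HomeoCircle) :
    ∃ F : ℝ ≃ₜ ℝ, ∀ x, Circle.exp (F x) = f (Circle.exp x) := by
  obtain ⟨y, hy⟩ : ∃ y, Circle.exp y = f (Circle.exp 0) := ⟨_, Circle.exp_arg _⟩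
  obtain ⟨F, ⟨hF0, hF⟩, -⟩ := Circle.isCoveringMap_exp.existsUnique_continuousMap_lifts
    ⟨fun x => f (Circle.exp x), by fun_prop⟩ 0 y hy
  obtain ⟨G, ⟨hG0, hG⟩, -⟩ := Circle.isCoveringMap_exp.existsUnique_continuousMap_lifts
    ⟨fun x => f.symm (Circle.exp x), by fun_prop⟩ y 0 (by simp [hy])
  have hF' (x) : Circle.exp (F x) = f (Circle.exp x) := congrFun hF x
  have hG' (x) : Circle.exp (G x) = f.symm (Circle.exp x) := congrFun hG x
  -- Both composites lift `Circle.exp` and fix a base point, so uniqueness of lifts makes them the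
  -- identity.
  have hGF : G ∘ F = id := Circle.isCoveringMap_exp.eq_of_comp_eq (by fun_prop) continuous_id
    (by ext x; simp [hF', hG']) 0 (by simp [hF0, hG0])
  have hFG : F ∘ G = id := Circle.isCoveringMap_exp.eq_of_comp_eq (by fun_prop) continuous_id
    (by ext x; simp [hF', hG']) y (by simp [hF0, hG0])
  exact ⟨⟨⟨F, G, congrFun hGF, congrFun hFG⟩, F.continuous, G.continuous⟩, hF'⟩

theorem exists_eq_add_of_exp_eq {F : ℝ → ℝ} (hc : Continuous F)
    (hF : ∀ x, Circle.exp (F x) = Circle.exp x) :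
    ∃ d : ℤ, ∀ x, F x = x + d * (2 * Real.pi) := by
  obtain ⟨d, hd⟩ := Circle.exp_eq_exp.1 (hF 0)
  refine ⟨d, congrFun (g := fun x => x + d * (2 * Real.pi)) ?_⟩
  refine Circle.isCoveringMap_exp.eq_of_comp_eq hc (by fun_prop) ?_ 0 hd
  funext x
  exact (hF x).trans (Circle.exp_eq_exp.2 ⟨d, rfl⟩).symm

theorem exists_orientation :
    ∃ s : (ℝ ≃ₜ ℝ) →* ℤˣ, ∀ F, s F = 1 ↔ StrictMono F := by
  classical
  have h (F : ℝ ≃ₜ ℝ) : StrictMono F ∨ StrictAnti F := F.continuous.strictMono_of_inj F.injective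
  have h' {F : ℝ ≃ₜ ℝ} (hF : StrictAnti F) : ¬ StrictMono F := fun hF' =>
    absurd (hF zero_lt_one) (hF' zero_lt_one).asymm
  refine ⟨MonoidHom.mk' (fun F => if StrictMono F then 1 else -1) fun F G => ?_, fun F => ?_⟩
  · rcases h F with hF | hF <;> rcases h G with hG | hG
    · have : StrictMono (F * G) := hF.comp hG
      simp [hF, hG, this]
    · have : StrictAnti (F * G) := hF.comp_strictAnti hG
      simp [hF, h' hG, h' this]
    · have : StrictAnti (F * G) := hF.comp_strictMono hG
      simp [h' hF, hG, h' this]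
    · have : StrictMono (F * G) := hF.comp hG
      simp [h' hF, h' hG, this]
  · by_cases hF : StrictMono F <;> simp [hF]

/-- The graph of the relation "`F` is a lift of `f`" between homeomorphisms of the line and of
the circle. -/
def homeomorphLifts : Subgroup ((ℝ ≃ₜ ℝ) × HomeoCircle) where
  carrier := {p | ∀ x, Circle.exp (p.1 x) = p.2 (Circle.exp x)}
  mul_mem' {p q} hp hq x := (hp (q.1 x)).trans (congrArg p.2 (hq x))
  one_mem' _ := rfl
  inv_mem' {p} hp x := by
    rw [← p.2.injective.eq_iff]
    change p.2 _ = p.2 (p.2.symm _)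
    rw [← hp, Homeomorph.apply_symm_apply]
    exact congrArg Circle.exp (p.1.apply_symm_apply x)

/-- The relator lifts to a translation, which is increasing. Its exponent sum is 5 in `B` and 0 in
`A`, so its orientation sign is that of `B`. -/
theorem strictMono_lifts_of_relators {α β : HomeoCircle} {A B : ℝ ≃ₜ ℝ}
    (hα : (A, α) ∈ homeomorphLifts) (hβ : (B, β) ∈ homeomorphLifts)
    (h : β * α * β * α * β * α⁻¹ * β ^ 2 * α⁻¹ = 1) : StrictMono B := by
  obtain ⟨s, hs⟩ := exists_orientation
  have hW : (B, β) * (A, α) * (B, β) * (A, α) * (B, β) * (A, α)⁻¹ * (B, β) ^ 2 * (A, α)⁻¹ ∈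
      homeomorphLifts := by
    repeat' first | exact hα | exact hβ | apply mul_mem | apply inv_mem
  have e : (B, β) * (A, α) * (B, β) * (A, α) * (B, β) * (A, α)⁻¹ * (B, β) ^ 2 * (A, α)⁻¹ =
      (B * A * B * A * B * A⁻¹ * B ^ 2 * A⁻¹, 1) := by rw [← h]; rfl
  rw [e] at hW
  obtain ⟨d, hd⟩ := exists_eq_add_of_exp_eq
    (B * A * B * A * B * A⁻¹ * B ^ 2 * A⁻¹ : ℝ ≃ₜ ℝ).continuous hW
  have hmono : StrictMono (B * A * B * A * B * A⁻¹ * B ^ 2 * A⁻¹ : ℝ ≃ₜ ℝ) := fun x y hxy => by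
    rw [hd, hd]
    linarith
  rw [← hs] at hmono ⊢
  simp only [map_mul, map_inv, map_pow] at hmono
  revert hmono
  generalize s A = u
  generalize s B = v
  revert u v
  decide

/-- Translation of the line by `2π`. -/
noncomputable def shift : ℝ ≃o ℝ := OrderIso.addRight (2 * Real.pi)

@[simp]
theorem shift_apply (x : ℝ) : shift x = x + 2 * Real.pi := rfl

theorem shift_zpow_apply (k : ℤ) (x : ℝ) : (shift ^ k) x = x + k * (2 * Real.pi) := by
  induction k generalizing x with
  | zero => simp
  | succ k ih =>
    rw [zpow_add_one, RelIso.mul_apply, ih]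
    push_cast
    rw [shift_apply]
    ring
  | pred k ih =>
    rw [zpow_sub_one, RelIso.mul_apply, ih]
    have : shift⁻¹ x = x - 2 * Real.pi := by
      change shift.symm x = _
      rw [OrderIso.symm_apply_eq, shift_apply]; ring
    rw [this]
    push_cast
    ring

/-- The order automorphisms of the line commuting with `shift`. -/
abbrev PeriodicOrderIso : Subgroup (ℝ ≃o ℝ) := Subgroup.centralizer {shift}

/-- `shift` as an element of its centralizer. -/
noncomputable def periodicShift : PeriodicOrderIso :=
  ⟨shift, Subgroup.mem_centralizer_singleton_iff.2 rfl⟩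

theorem mul_periodicShift (g : PeriodicOrderIso) : g * periodicShift = periodicShift * g :=
  Subtype.ext (Subgroup.mem_centralizer_singleton_iff.1 g.2)

theorem periodicShift_zpow_apply (k : ℤ) (x : ℝ) :
    (periodicShift ^ k : PeriodicOrderIso).1 x = x + k * (2 * Real.pi) := by
  rw [Subgroup.coe_zpow]
  exact shift_zpow_apply k x

/-- The elements of `PeriodicOrderIso` moving `x` to the right. -/
def moveRight (x : ℝ) : Submonoid PeriodicOrderIso where
  carrier := {g | x ≤ g.1 x}
  mul_mem' {g _} hg hh := le_trans hg (g.1.monotone hh)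
  one_mem' := le_refl x

theorem isSeparatingFamily_moveRight : IsSeparatingFamily moveRight where
  total x g := by
    rcases le_total x (g.1 x) with h | h
    · exact .inl h
    · refine .inr ?_
      change x ≤ g.1.symm x
      rwa [OrderIso.le_symm_apply]
  eq_one g hg := by
    ext x
    obtain ⟨h1, h2⟩ := hg x
    change x ≤ g.1.symm x at h2
    rw [OrderIso.le_symm_apply] at h2
    exact le_antisymm h2 h1

/-- The graph of the relation "`F` is a lift of `f`" between periodic order automorphisms of the
line and homeomorphisms of the circle. -/
def lifts : Subgroup (PeriodicOrderIso × HomeoCircle) where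
  carrier := {p | ∀ x, Circle.exp (p.1.1 x) = p.2 (Circle.exp x)}
  mul_mem' {p q} hp hq x := (hp (q.1.1 x)).trans (congrArg p.2 (hq x))
  one_mem' _ := rfl
  inv_mem' {p} hp x := by
    rw [← p.2.injective.eq_iff]
    change p.2 _ = p.2 (p.2.symm _)
    rw [← hp, Homeomorph.apply_symm_apply]
    exact congrArg Circle.exp (p.1.1.apply_symm_apply x)

theorem exists_zpow_of_mem_lifts {g : PeriodicOrderIso} (h : (g, 1) ∈ lifts) :
    ∃ k : ℤ, g = periodicShift ^ k := by
  obtain ⟨k, hk⟩ := exists_eq_add_of_exp_eq g.1.continuous h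
  refine ⟨k, Subtype.ext <| RelIso.ext fun x => ?_⟩
  rw [periodicShift_zpow_apply]
  exact hk x

theorem eq_one_of_mem_lifts {k : ℤ} {f : HomeoCircle} (h : (periodicShift ^ k, f) ∈ lifts) :
    f = 1 := by
  ext1 y
  obtain ⟨x, rfl⟩ : ∃ x, Circle.exp x = y := ⟨_, Circle.exp_arg y⟩
  rw [← h x]
  exact Circle.exp_eq_exp.2 ⟨k, periodicShift_zpow_apply k x⟩

/-- The point is that an increasing lift has degree `d = 1`, hence commutes with `shift`. -/
theorem exists_mem_lifts {f : HomeoCircle} {F : ℝ ≃ₜ ℝ} (hF : (F, f) ∈ homeomorphLifts)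
    (hm : StrictMono F) : ∃ A, (A, f) ∈ lifts := by
  have hpi := Real.pi_pos
  have hexp (x : ℝ) : Circle.exp (F x) = f (Circle.exp x) := hF x
  obtain ⟨d, hd⟩ : ∃ d : ℤ, ∀ x, F (F.symm x + 2 * Real.pi) = x + d * (2 * Real.pi) :=
    exists_eq_add_of_exp_eq (by fun_prop) fun x => by
      rw [hexp, Circle.periodic_exp, ← hexp, F.apply_symm_apply]
  have hd' (x) : F (x + 2 * Real.pi) = F x + d * (2 * Real.pi) := by simpa using hd (F x)
  have hpos : 0 < d := by
    have : F 0 < F (0 + 2 * Real.pi) := hm (by linarith)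
    rw [hd'] at this
    have : 0 < (d : ℝ) * (2 * Real.pi) := by linarith
    exact_mod_cast (pos_iff_pos_of_mul_pos this).2 (by positivity)
  -- If `2 ≤ d`, some `y` strictly between 0 and 2π has `F y = F 0 + 2π`, contradicting injectivity
  -- of `f`.
  have hle : ¬ 2 ≤ d := by
    intro h2
    have h2' : (2 : ℝ) ≤ d := by exact_mod_cast h2
    obtain ⟨y, hy⟩ := F.surjective (F 0 + 2 * Real.pi)
    have h0 : 0 < y := hm.lt_iff_lt.1 (by linarith)
    have h1 : y < 0 + 2 * Real.pi := hm.lt_iff_lt.1 (by rw [hd', hy]; nlinarith)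
    have : Circle.exp y = Circle.exp 0 := by
      rw [← f.injective.eq_iff, ← hexp, ← hexp, hy, Circle.periodic_exp]
    obtain ⟨k, hk⟩ := Circle.exp_eq_exp.1 this
    have hk0 : (0 : ℝ) < k := by nlinarith
    have hk1 : (k : ℝ) < 1 := by nlinarith
    norm_cast at hk0 hk1
    lia
  obtain rfl : d = 1 := by lia
  refine ⟨⟨hm.orderIsoOfSurjective F F.surjective, ?_⟩, hF⟩
  rw [Subgroup.mem_centralizer_singleton_iff]
  ext x
  change F (x + 2 * Real.pi) = F x + 2 * Real.pi
  rw [hd']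
  simp

theorem eq_one_or_exists_zpow_of_relators {α β : HomeoCircle}
    (h1 : β * α * β * α * β * α⁻¹ * β ^ 2 * α⁻¹ = 1)
    (h2 : α * β * α * β * α * β⁻¹ * α ^ 2 * β⁻¹ = 1) :
    β = 1 ∨ ∃ k : ℤ, α = β ^ k := by
  obtain ⟨A₀, hA₀⟩ := exists_homeomorph_lift α
  obtain ⟨B₀, hB₀⟩ := exists_homeomorph_lift β
  obtain ⟨A, hA⟩ := exists_mem_lifts hA₀ (strictMono_lifts_of_relators hB₀ hA₀ h2)
  obtain ⟨B, hB⟩ := exists_mem_lifts hB₀ (strictMono_lifts_of_relators hA₀ hB₀ h1)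
  have key (g h : PeriodicOrderIso) (γ δ : HomeoCircle) (hg : (g, γ) ∈ lifts) (hh : (h, δ) ∈ lifts)
      (hr : γ * δ * γ * δ * γ * δ⁻¹ * γ ^ 2 * δ⁻¹ = 1) :
      ∃ k : ℤ, g * h * g * h * g * h⁻¹ * g ^ 2 * h⁻¹ = periodicShift ^ k := by
    refine exists_zpow_of_mem_lifts ?_
    have hW : (g, γ) * (h, δ) * (g, γ) * (h, δ) * (g, γ) * (h, δ)⁻¹ * (g, γ) ^ 2 * (h, δ)⁻¹ ∈
        lifts := by
      repeat' first | exact hg | exact hh | apply mul_mem | apply inv_mem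
    rw [← hr]
    exact hW
  obtain ⟨m, hm⟩ := key B A β α hB hA h1
  obtain ⟨n, hn⟩ := key A B α β hA hB h2
  rcases isSeparatingFamily_moveRight.exists_powers_of_relators mul_periodicShift hm hn with
    ⟨k, rfl⟩ | ⟨k, l, hkl⟩
  · exact .inl (eq_one_of_mem_lifts hB)
  · refine .inr ⟨k, ?_⟩
    -- The lift of `(β ^ k)⁻¹ * α` is a power of the translation, which covers the identity of the
    -- circle.
    rw [← inv_mul_eq_one, ← inv_eq_one]
    refine eq_one_of_mem_lifts (k := l) ?_
    have : ((B, β) ^ k)⁻¹ * (A, α) ∈ lifts := mul_mem (inv_mem (zpow_mem hB k)) hA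
    have e : ((B, β) ^ k)⁻¹ * (A, α) = (periodicShift ^ l, (α⁻¹ * β ^ k)⁻¹) := by
      ext1
      · change (B ^ k)⁻¹ * A = _
        rw [hkl, inv_mul_cancel_left]
      · change (β ^ k)⁻¹ * α = _
        rw [mul_inv_rev, inv_inv]
    rwa [← e]

end CircleLift

/-! ### The image is cyclic of order dividing 5. -/

theorem exists_zpowers_of_relators {G : Type*} [Group G] {α β : G}
    (h1 : β * α * β * α * β * α⁻¹ * β ^ 2 * α⁻¹ = 1)
    (h2 : α * β * α * β * α * β⁻¹ * α ^ 2 * β⁻¹ = 1)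
    (h : β = 1 ∨ ∃ k : ℤ, α = β ^ k) :
    ∃ g : G, g ^ 5 = 1 ∧ Subgroup.closure {α, β} = Subgroup.zpowers g := by
  rcases h with rfl | ⟨k, rfl⟩
  · refine ⟨α, ?_, ?_⟩
    · simpa [pow_succ, mul_assoc] using h2
    · rw [Set.pair_comm, Subgroup.closure_insert_one, Subgroup.zpowers_eq_closure]
  · refine ⟨β, ?_, ?_⟩
    · rwa [relator_eq_pow_of_commute ((Commute.refl β).zpow_right k)] at h1
    · refine le_antisymm ((Subgroup.closure_le _).2 ?_) ?_
      · rintro x (hx | hx)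
        · exact hx ▸ Subgroup.zpow_mem_zpowers β k
        · exact hx ▸ Subgroup.mem_zpowers β
      · rw [Subgroup.zpowers_le]
        exact Subgroup.subset_closure (Set.mem_insert_of_mem _ (Set.mem_singleton β))

theorem zpowers_eq_bot_or_equiv {G : Type*} [Group G] {g : G} {p : ℕ} [Fact p.Prime]
    (hg : g ^ p = 1) :
    Subgroup.zpowers g = ⊥ ∨ Nonempty (Subgroup.zpowers g ≃* Multiplicative (ZMod p)) := by
  rcases eq_or_ne g 1 with rfl | h
  · exact .inl Subgroup.zpowers_one_eq_bot
  · have hc : Nat.card (Subgroup.zpowers g) = p := by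
      rw [Nat.card_zpowers, orderOf_eq_prime hg h]
    have e := zmodCyclicMulEquiv (inferInstance : IsCyclic (Subgroup.zpowers g))
    rw [hc] at e
    exact .inr ⟨e.symm⟩

theorem range_eq_closure (ρ : WeeksGroup →* HomeoCircle) :
    ρ.range = Subgroup.closure {ρ (PresentedGroup.of 0), ρ (PresentedGroup.of 1)} := by
  rw [MonoidHom.range_eq_map, ← PresentedGroup.closure_range_of, MonoidHom.map_closure]
  congr 1
  ext x
  simp [Fin.exists_fin_two, eq_comm]

theorem mainTheorem12 (ρ : WeeksGroup →* HomeoCircle) :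
    ρ.range = ⊥ ∨ Nonempty (ρ.range ≃* Multiplicative (ZMod 5)) := by
  set a : WeeksGroup := PresentedGroup.of 0
  set b : WeeksGroup := PresentedGroup.of 1
  have e1 : b * a * b * a * b * a⁻¹ * b ^ 2 * a⁻¹ = 1 :=
    PresentedGroup.one_of_mem (Set.mem_insert WeeksManifold.relator₁ _)
  have e2 : a * b * a * b * a * b⁻¹ * a ^ 2 * b⁻¹ = 1 :=
    PresentedGroup.one_of_mem (Set.mem_insert_of_mem WeeksManifold.relator₁ rfl)
  have h1 := congrArg ρ e1
  have h2 := congrArg ρ e2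
  simp only [map_mul, map_inv, map_pow, map_one] at h1 h2
  obtain ⟨g, hg, hr⟩ := exists_zpowers_of_relators h1 h2
    (CircleLift.eq_one_or_exists_zpow_of_relators h1 h2)
  have hr' : ρ.range = Subgroup.zpowers g := (range_eq_closure ρ).trans hr
  have : Fact (Nat.Prime 5) := ⟨Nat.prime_five⟩
  rw [hr']
  exact zpowers_eq_bot_or_equiv hg
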